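/- Let $H$ be a Hamiltonian on an infinite-dimensional separable complex Hilbert space $A$: a densely defined, in general unbounded, self-adjoint operator with discrete spectrum (there is an orthonormal basis of $A$ consisting of eigenvectors of $H$) and with ground state energy $0$, i.e. the smallest eigenvalue of $H$ is $0$. Assume the Gibbs Hypothesis: $Z(\beta) := \operatorname{tr} e^{-\beta H} < \infty$ for every $\beta > 0$. For a state $\rho$ on $A$ let $S(\rho) = -\operatorname{tr}\rho\log\rho \in [0,\infty]$ be its von Neumann entropy, with logarithms to an arbitrary fixed base $a>1$. For $E > 0$ let \[ \gamma(E) = \frac{1}{Z(\beta(E))}\, e^{-\beta(E) H} \] be the Gibbs state of energy $E$, where $\beta = \beta(E) > 0$ is the solution of $\operatorname{tr} e^{-\beta H}(H-E) = 0$, and let $\gamma(0) = P_0/\operatorname{tr}P_0$ (the limiting case $\beta=\infty$), where $P_0$ is the projection onto the ground space $\ker H$. Then for every $E \ge 0$ and every $\delta > 0$, \[ \sup_{0<\lambda\leq\delta} \lambda\, S\bigl(\gamma(E/\lambda)\bigr) = \delta\, S\bigl(\gamma(E/\delta)\bigr) < \infty . \] That is, $\lambda\, S(\gamma(E/\lambda))$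 is maximized at the largest admissible $\lambda$. -/

import Mathlib

open scoped ENNReal InnerProductSpace

/-- `x` lies in the domain of the (unbounded) operator `T` and `T x = e x`. -/
def IsEigenpair {A : Type*} [NormedAddCommGroup A] [InnerProductSpace ℂ A]
    (T : A →ₗ.[ℂ] A) (e : ℝ) (x : A) : Prop :=
  ∃ h : x ∈ T.domain, T ⟨x, h⟩ = (e : ℂ) • x

/-- The (real) eigenvalues of the operator `T`. -/
def pointSpectrum {A : Type*} [NormedAddCommGroup A] [InnerProductSpace ℂ A]
    (T : A →ₗ.[ℂ] A) : Set ℝ :=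
  {e | ∃ x : A, x ≠ 0 ∧ IsEigenpair T e x}

/-- A Hamiltonian on an infinite-dimensional separable Hilbert space: a densely defined, in general
unbounded, self-adjoint operator with discrete spectrum, that is, with an orthonormal basis of
eigenvectors, and with ground state energy `0`. The index type `ℕ` of the basis says that the space
is separable and infinite-dimensional. -/
structure Hamiltonian (A : Type*) [NormedAddCommGroup A] [InnerProductSpace ℂ A]
    [CompleteSpace A] where
  op : A →ₗ.[ℂ] A
  dense_domain : Dense (op.domain : Set A)
  selfAdjoint : IsSelfAdjoint op
  exists_eigenbasis : ∃ b : HilbertBasis ℕ ℂ A, ∀ n, ∃ e : ℝ, IsEigenpair op e (b n)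
  ground_energy : IsLeast (pointSpectrum op) 0

/-- The trace of a positive operator, with values in `[0, ∞]`: the sum of its diagonal entries in an
orthonormal basis. The value does not depend on the basis. -/
noncomputable def posTrace {A : Type*} [NormedAddCommGroup A] [InnerProductSpace ℂ A]
    [CompleteSpace A] (T : A →L[ℂ] A) : ℝ≥0∞ :=
  ∑' i, ENNReal.ofReal
    (⟪(exists_hilbertBasis ℂ A).choose_spec.choose i,
      T ((exists_hilbertBasis ℂ A).choose_spec.choose i)⟫_ℂ).re

/-- The von Neumann entropy `S(ρ) = - tr ρ log_a ρ` of a state `ρ`, with values in `[0, ∞]`. -/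
noncomputable def vonNeumannEntropy {A : Type*} [NormedAddCommGroup A] [InnerProductSpace ℂ A]
    [CompleteSpace A] (a : ℝ) (ρ : A →L[ℂ] A) : ℝ≥0∞ :=
  posTrace (cfc (fun x : ℝ => -(x * Real.logb a x)) ρ)

namespace Hamiltonian

/-- `T = f(H)`: the bounded operator `T` multiplies each eigenvector of `H`, of energy `e`,
by `f e`. -/
def IsFunctionOf {A : Type*} [NormedAddCommGroup A] [InnerProductSpace ℂ A] [CompleteSpace A]
    (H : Hamiltonian A) (f : ℝ → ℝ) (T : A →L[ℂ] A) : Prop :=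
  ∀ (e : ℝ) (x : A), IsEigenpair H.op e x → T x = (f e : ℂ) • x

/-- If `f` is bounded on the eigenvalues of `H`, there is exactly one bounded operator `f(H)`. -/
theorem existsUnique_isFunctionOf {A : Type*} [NormedAddCommGroup A] [InnerProductSpace ℂ A]
    [CompleteSpace A] (H : Hamiltonian A) (f : ℝ → ℝ) (C : ℝ)
    (hf : ∀ e ∈ pointSpectrum H.op, |f e| ≤ C) :
    ∃! T : A →L[ℂ] A, H.IsFunctionOf f T := by
  obtain ⟨b, hb⟩ := H.exists_eigenbasis
  choose E hE using hb
  have hbne : ∀ n, b n ≠ 0 := fun n => b.orthonormal.ne_zero n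
  have hC : ∀ n, |f (E n)| ≤ C := fun n => hf _ ⟨b n, hbne n, hE n⟩
  have hC0 : 0 ≤ C := (abs_nonneg _).trans (hC 0)
  have hle : ∀ (c : lp (fun _ : ℕ => ℂ) 2) (n : ℕ),
      ‖(f (E n) : ℂ) * c n‖ ≤ ‖((C : ℂ) • c) n‖ := by
    intro c n
    have h : |f (E n)| ≤ |C| := (hC n).trans (le_abs_self C)
    change ‖(f (E n) : ℂ) * c n‖ ≤ ‖(C : ℂ) * c n‖
    simpa only [norm_mul, Complex.norm_real, Real.norm_eq_abs] using
      mul_le_mul_of_nonneg_right h (norm_nonneg (c n))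
  have hmem : ∀ c : lp (fun _ : ℕ => ℂ) 2, Memℓp (fun n => (f (E n) : ℂ) * c n) 2 :=
    fun c => (lp.memℓp ((C : ℂ) • c)).mono' (hle c)
  let D₀ : lp (fun _ : ℕ => ℂ) 2 →ₗ[ℂ] lp (fun _ : ℕ => ℂ) 2 :=
    { toFun := fun c => ⟨fun n => (f (E n) : ℂ) * c n, hmem c⟩
      map_add' := fun c d => by ext n; exact mul_add _ _ _
      map_smul' := fun k c => by ext n; exact mul_left_comm _ _ _ }
  let D : lp (fun _ : ℕ => ℂ) 2 →L[ℂ] lp (fun _ : ℕ => ℂ) 2 :=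
    D₀.mkContinuous C (fun c => by
      have h : ‖D₀ c‖ ≤ ‖(C : ℂ) • c‖ := lp.norm_mono (by norm_num) (hle c)
      rwa [norm_smul, Complex.norm_real, Real.norm_of_nonneg hC0] at h)
  let T : A →L[ℂ] A :=
    (b.repr.symm.toContinuousLinearEquiv : lp (fun _ : ℕ => ℂ) 2 →L[ℂ] A) ∘L D ∘L
      (b.repr.toContinuousLinearEquiv : A →L[ℂ] lp (fun _ : ℕ => ℂ) 2)
  have hT : ∀ x n, b.repr (T x) n = (f (E n) : ℂ) * b.repr x n := by
    intro x n
    have h : b.repr (T x) = D (b.repr x) := b.repr.apply_symm_apply _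
    rw [h]
    rfl
  have hsymm : H.op.IsFormalAdjoint H.op := by
    have h := LinearPMap.adjoint_isFormalAdjoint H.dense_domain
    rwa [LinearPMap.isSelfAdjoint_def.1 H.selfAdjoint] at h
  refine ⟨T, ?_, ?_⟩
  · rintro e x ⟨hx, hex⟩
    apply b.repr.injective
    ext n
    rw [hT, map_smul]
    change _ = (f e : ℂ) * b.repr x n
    by_cases h : E n = e
    · rw [h]
    · obtain ⟨hn, hen⟩ := hE n
      have h1 := hsymm ⟨b n, hn⟩ ⟨x, hx⟩
      rw [hen, hex, inner_smul_left, inner_smul_right, Complex.conj_ofReal] at h1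
      have h2 : ((E n : ℂ) - e) * ⟪b n, x⟫_ℂ = 0 := by rw [sub_mul]; exact sub_eq_zero.2 h1
      have h3 : ((E n : ℂ) - e) ≠ 0 := sub_ne_zero.2 (by exact_mod_cast h)
      rw [b.repr_apply_apply, (mul_eq_zero.1 h2).resolve_left h3, mul_zero, mul_zero]
  · intro T' hT'
    have hd : Dense (Submodule.span ℂ (Set.range b) : Set A) :=
      Submodule.dense_iff_topologicalClosure_eq_top.2 b.dense_span
    refine ContinuousLinearMap.ext_on hd ?_
    rintro _ ⟨n, rfl⟩
    rw [hT' _ _ (hE n)]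
    apply b.repr.injective
    ext m
    rw [hT, map_smul]
    change (f (E n) : ℂ) * b.repr (b n) m = _
    by_cases h : m = n
    · rw [h]
    · rw [b.repr_apply_apply, b.orthonormal.2 h, mul_zero, mul_zero]

open Classical in
/-- The bounded operator `f(H)`, for `f` bounded on the eigenvalues of `H` (and `0` if there is no
such bounded operator). -/
noncomputable def fc {A : Type*} [NormedAddCommGroup A] [InnerProductSpace ℂ A] [CompleteSpace A]
    (H : Hamiltonian A) (f : ℝ → ℝ) : A →L[ℂ] A :=
  if h : ∃ T : A →L[ℂ] A, H.IsFunctionOf f T then h.choose else 0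

/-- The partition function `Z(β) = tr e^{-βH}`, with values in `[0, ∞]`. -/
noncomputable def partitionFunction {A : Type*} [NormedAddCommGroup A] [InnerProductSpace ℂ A]
    [CompleteSpace A] (H : Hamiltonian A) (β : ℝ) : ℝ≥0∞ :=
  posTrace (H.fc fun x => Real.exp (-β * x))

/-- The Gibbs Hypothesis: the partition function is finite at every `β > 0`. -/
def GibbsHypothesis {A : Type*} [NormedAddCommGroup A] [InnerProductSpace ℂ A]
    [CompleteSpace A] (H : Hamiltonian A) : Prop :=
  ∀ β : ℝ, 0 < β → H.partitionFunction β < ∞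

/-- `β > 0` solves `tr e^{-βH} (H - E) = 0`, written as `tr (H e^{-βH}) = E tr e^{-βH}`, so that
both sides are traces of positive operators. -/
def IsInverseTemperature {A : Type*} [NormedAddCommGroup A] [InnerProductSpace ℂ A]
    [CompleteSpace A] (H : Hamiltonian A) (E β : ℝ) : Prop :=
  0 < β ∧ posTrace (H.fc fun x => x * Real.exp (-β * x)) =
    ENNReal.ofReal E * H.partitionFunction β

/-- The inverse temperature `β(E)`, for `E > 0`. -/
noncomputable def inverseTemperature {A : Type*} [NormedAddCommGroup A] [InnerProductSpace ℂ A]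
    [CompleteSpace A] (H : Hamiltonian A) (E : ℝ) : ℝ :=
  Classical.epsilon fun β => H.IsInverseTemperature E β

open Classical in
/-- The Gibbs state `γ(E)` of energy `E ≥ 0`. For `E > 0` it is `e^{-β(E)H} / Z(β(E))`; at the ground
state energy `E = 0`, where `β(E) = ∞`, it is the normalized projection onto the ground space. -/
noncomputable def gibbsState {A : Type*} [NormedAddCommGroup A] [InnerProductSpace ℂ A]
    [CompleteSpace A] (H : Hamiltonian A) (E : ℝ) : A →L[ℂ] A :=
  if E = 0 then
    (((posTrace (H.fc fun x => if x = 0 then 1 else 0)).toReal⁻¹ : ℝ) : ℂ) •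
      H.fc fun x => if x = 0 then 1 else 0
  else
    (((H.partitionFunction (H.inverseTemperature E)).toReal⁻¹ : ℝ) : ℂ) •
      H.fc fun x => Real.exp (-(H.inverseTemperature E) * x)

end Hamiltonian

/-! For `E > 0` the entropy of `γ(E)` is, up to the factor `log a`, the minimum over `β > 0` of `β E
+ log Z(β)` (`vonNeumannEntropy_gibbsState`, `gibbs_variational`). Hence `λ S(γ(E/λ))` is the
minimum of `β E + λ log Z(β)`. Since the ground energy is `0`, `Z(β) ≥ 1`, so each of these
functions is nondecreasing in `λ`, and so is their minimum. For `E = 0` the state does not depend on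
`λ`.

The remaining work is to show that `β(E)` exists (`exists_tsum_mul_exp_neg_eq`) and to turn traces
and entropies of functions of `H` into sums over an eigenbasis (`posTrace_of_diagonal`,
`cfc_apply_eigenvector`). -/

/-! ### Boltzmann sums over a family of energies -/

theorem summable_mul_exp_neg {ι : Type*} {e : ι → ℝ} (he : ∀ n, 0 ≤ e n)
    (hs : ∀ β : ℝ, 0 < β → Summable fun n => Real.exp (-β * e n)) {β : ℝ} (hβ : 0 < β) :
    Summable fun n => e n * Real.exp (-β * e n) := by
  refine Summable.of_nonneg_of_le (fun n => mul_nonneg (he n) (Real.exp_pos _).le) (fun n => ?_)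
    ((hs (β / 2) (half_pos hβ)).mul_left (2 / β))
  have h1 : e n ≤ 2 / β * Real.exp (β / 2 * e n) := by
    have h2 : 2 / β * (β / 2 * e n) = e n := by field_simp
    have h3 : β / 2 * e n ≤ Real.exp (β / 2 * e n) := by
      linarith [Real.add_one_le_exp (β / 2 * e n)]
    calc e n = 2 / β * (β / 2 * e n) := h2.symm
      _ ≤ _ := by gcongr
  calc e n * Real.exp (-β * e n)
      ≤ 2 / β * Real.exp (β / 2 * e n) * Real.exp (-β * e n) := by gcongr
    _ = 2 / β * Real.exp (-(β / 2) * e n) := by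
      rw [mul_assoc, ← Real.exp_add]; ring_nf

theorem summable_sub_mul_exp_neg {ι : Type*} {e : ι → ℝ} (he : ∀ n, 0 ≤ e n)
    (hs : ∀ β : ℝ, 0 < β → Summable fun n => Real.exp (-β * e n)) (E : ℝ) {β : ℝ} (hβ : 0 < β) :
    Summable fun n => (e n - E) * Real.exp (-β * e n) := by
  simp only [sub_mul]
  exact (summable_mul_exp_neg he hs hβ).sub ((hs β hβ).mul_left E)

/-- Small `β` makes the weights nearly equal. Only finitely many levels (`K`) lie below `E + 1`;
enough of the infinitely many others (`F`), each contributing at least `1` at `β = 0`, outweigh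
them. Continuity of this finite sum carries the sign to some `β > 0`, and all omitted terms are
nonnegative. -/
theorem exists_tsum_sub_mul_exp_neg_nonneg {ι : Type*} [Infinite ι] {e : ι → ℝ}
    (he : ∀ n, 0 ≤ e n) (hs : ∀ β : ℝ, 0 < β → Summable fun n => Real.exp (-β * e n)) (E : ℝ) :
    ∃ β : ℝ, 0 < β ∧ 0 ≤ ∑' n, (e n - E) * Real.exp (-β * e n) := by
  classical
  have hfin : {n | e n < E + 1}.Finite := by
    have h := (hs 1 one_pos).tendsto_cofinite_zero.eventually
      (gt_mem_nhds (Real.exp_pos (-(E + 1))))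
    refine (Filter.eventually_cofinite.1 h).subset fun n hn => ?_
    have hn' : e n < E + 1 := hn
    simp only [Set.mem_ofPred_eq, not_lt, Real.exp_le_exp]
    linarith
  set K := hfin.toFinset with hK
  have hKmem : ∀ n, n ∉ K → E + 1 ≤ e n := fun n hn => by simpa [hK] using hn
  obtain ⟨m, hm⟩ := exists_nat_gt (∑ n ∈ K, (E - e n))
  obtain ⟨F, hFK, hF⟩ := Set.Infinite.exists_subset_card_eq K.finite_toSet.infinite_compl m
  have hdisj : Disjoint K F := Finset.disjoint_right.2 fun n hn => by simpa using hFK hn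
  set φ : ℝ → ℝ := fun β => ∑ n ∈ K ∪ F, (e n - E) * Real.exp (-β * e n) with hφ
  have hφc : Continuous φ := by fun_prop
  have hφ0 : 0 < φ 0 := by
    simp only [hφ, neg_zero, zero_mul, Real.exp_zero, mul_one]
    rw [Finset.sum_union hdisj]
    have h1 : (m : ℝ) ≤ ∑ n ∈ F, (e n - E) := by
      rw [← hF, Finset.cast_card]
      exact Finset.sum_le_sum fun n hn => by linarith [hKmem n (by simpa using hFK hn)]
    have h2 : ∑ n ∈ K, (e n - E) = -∑ n ∈ K, (E - e n) := by
      rw [← Finset.sum_neg_distrib]; simp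
    linarith
  obtain ⟨ε, hε, hball⟩ := Metric.eventually_nhds_iff.1
    (hφc.continuousAt.eventually (lt_mem_nhds hφ0))
  refine ⟨ε / 2, half_pos hε, ?_⟩
  have h3 : 0 < φ (ε / 2) := hball (by
    rw [Real.dist_eq, sub_zero, abs_of_pos (half_pos hε)]; exact half_lt_self hε)
  refine h3.le.trans ((summable_sub_mul_exp_neg he hs E (half_pos hε)).sum_le_tsum _ fun n hn => ?_)
  refine mul_nonneg ?_ (Real.exp_pos _).le
  linarith [hKmem n fun h => hn (Finset.mem_union_left _ h)]

/-- For large `β` the term `-E` of one ground level dominates: levels above `E` are damped by a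
further `exp (-(t * E))`, and levels below `E` only help. -/
theorem exists_tsum_sub_mul_exp_neg_nonpos {ι : Type*} {e : ι → ℝ} (he : ∀ n, 0 ≤ e n)
    {n₀ : ι} (h₀ : e n₀ = 0) (hs : ∀ β : ℝ, 0 < β → Summable fun n => Real.exp (-β * e n))
    {E : ℝ} (hE : 0 < E) :
    ∃ β : ℝ, 0 < β ∧ ∑' n, (e n - E) * Real.exp (-β * e n) ≤ 0 := by
  classical
  have hU := summable_mul_exp_neg he hs one_pos
  set U := ∑' n, e n * Real.exp (-1 * e n) with hUdef
  have hU0 : 0 ≤ U := tsum_nonneg fun n => mul_nonneg (he n) (Real.exp_pos _).le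
  -- Chosen so that `U = (t * E) * E ≤ exp (t * E) * E`; the damped tail is then at most `E`.
  set t := U / E ^ 2 with ht
  have ht0 : 0 ≤ t := by positivity
  have hβ : 0 < 1 + t := by linarith
  refine ⟨1 + t, hβ, ?_⟩
  have hsum : HasSum (fun n => Real.exp (-(t * E)) * (e n * Real.exp (-1 * e n)) +
      if n = n₀ then -E else 0) (Real.exp (-(t * E)) * U + -E) :=
    (hU.hasSum.mul_left _).add (hasSum_ite_eq n₀ (-E))
  have hle : ∀ n, (e n - E) * Real.exp (-(1 + t) * e n) ≤
      Real.exp (-(t * E)) * (e n * Real.exp (-1 * e n)) + if n = n₀ then -E else 0 := by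
    intro n
    by_cases hn : n = n₀
    · simp [hn, h₀]
    · simp only [hn, if_false, add_zero]
      rcases le_total (e n) E with h | h
      · exact (mul_nonpos_of_nonpos_of_nonneg (by linarith) (Real.exp_pos _).le).trans
          (mul_nonneg (Real.exp_pos _).le (mul_nonneg (he n) (Real.exp_pos _).le))
      · have h1 : Real.exp (-(1 + t) * e n) ≤ Real.exp (-(t * E)) * Real.exp (-1 * e n) := by
          rw [← Real.exp_add, Real.exp_le_exp]
          nlinarith [mul_le_mul_of_nonneg_left h ht0]
        calc (e n - E) * Real.exp (-(1 + t) * e n)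
            ≤ e n * (Real.exp (-(t * E)) * Real.exp (-1 * e n)) := by
              gcongr
              · exact he n
              · linarith
          _ = _ := by ring
  refine ((summable_sub_mul_exp_neg he hs E hβ).tsum_le_tsum hle hsum.summable).trans ?_
  rw [hsum.tsum_eq]
  have h2 : U ≤ Real.exp (t * E) * E := by
    have h3 : t * E * E = U := by rw [ht]; field_simp
    nlinarith [Real.add_one_le_exp (t * E)]
  have h4 : Real.exp (-(t * E)) * U ≤ Real.exp (-(t * E)) * (Real.exp (t * E) * E) := by gcongr
  rw [← mul_assoc, ← Real.exp_add, neg_add_cancel, Real.exp_zero, one_mul] at h4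
  linarith

theorem continuousOn_tsum_sub_mul_exp_neg {ι : Type*} {e : ι → ℝ} (he : ∀ n, 0 ≤ e n)
    (hs : ∀ β : ℝ, 0 < β → Summable fun n => Real.exp (-β * e n)) (E : ℝ) {β₀ : ℝ} (hβ₀ : 0 < β₀) :
    ContinuousOn (fun β : ℝ => ∑' n, (e n - E) * Real.exp (-β * e n)) (Set.Ici β₀) := by
  refine continuousOn_tsum (fun n => by fun_prop) (summable_sub_mul_exp_neg he hs E hβ₀).norm
    fun n β hβ => ?_
  rw [norm_mul, norm_mul, Real.norm_of_nonneg (Real.exp_pos _).le,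
    Real.norm_of_nonneg (Real.exp_pos _).le]
  gcongr
  · exact he n
  · exact hβ

/-- Every positive energy is the mean energy of a Gibbs distribution. -/
theorem exists_tsum_mul_exp_neg_eq {ι : Type*} [Infinite ι] {e : ι → ℝ} (he : ∀ n, 0 ≤ e n)
    {n₀ : ι} (h₀ : e n₀ = 0) (hs : ∀ β : ℝ, 0 < β → Summable fun n => Real.exp (-β * e n))
    {E : ℝ} (hE : 0 < E) :
    ∃ β : ℝ, 0 < β ∧ ∑' n, e n * Real.exp (-β * e n) = E * ∑' n, Real.exp (-β * e n) := by
  obtain ⟨b, hb, hgb⟩ := exists_tsum_sub_mul_exp_neg_nonneg he hs E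
  obtain ⟨c, hc, hgc⟩ := exists_tsum_sub_mul_exp_neg_nonpos he h₀ hs hE
  have hmin : 0 < min b c := lt_min hb hc
  obtain ⟨β, hβ, h⟩ := isPreconnected_Ici.intermediate_value₂
    (min_le_right b c : c ∈ Set.Ici (min b c)) (min_le_left b c : b ∈ Set.Ici (min b c))
    (continuousOn_tsum_sub_mul_exp_neg he hs E hmin) continuousOn_const hgc hgb
  have hβ0 : 0 < β := hmin.trans_le hβ
  refine ⟨β, hβ0, ?_⟩
  simp only [sub_mul] at h
  rw [(summable_mul_exp_neg he hs hβ0).tsum_sub ((hs β hβ0).mul_left E), tsum_mul_left] at h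
  linarith

theorem one_le_tsum_exp_neg {ι : Type*} {e : ι → ℝ} {n₀ : ι} (h₀ : e n₀ = 0) {β : ℝ}
    (hs : Summable fun n => Real.exp (-β * e n)) : 1 ≤ ∑' n, Real.exp (-β * e n) := by
  simpa [h₀] using hs.le_tsum n₀ fun n _ => (Real.exp_pos (-β * e n)).le

/-- The Gibbs variational principle: at fixed mean energy `E`, the entropy of the Gibbs distribution
minimizes `β E + log Z(β)`. -/
theorem gibbs_variational {ι : Type*} [Nonempty ι] {e : ι → ℝ} (he : ∀ n, 0 ≤ e n)
    (hs : ∀ β : ℝ, 0 < β → Summable fun n => Real.exp (-β * e n))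
    {E β β' : ℝ} (hβ : 0 < β) (hβ' : 0 < β')
    (h : ∑' n, e n * Real.exp (-β * e n) = E * ∑' n, Real.exp (-β * e n)) :
    β * E + Real.log (∑' n, Real.exp (-β * e n)) ≤
      β' * E + Real.log (∑' n, Real.exp (-β' * e n)) := by
  set Z := ∑' n, Real.exp (-β * e n) with hZ
  -- `Z(β') / Z(β)` is the mean of `exp ((β - β') * e n)` under the Gibbs weights at `β`, and `m` is
  -- the mean of the exponent. The tangent line of `exp` at `m` gives Jensen's inequality `exp m *
  -- Z(β) ≤ Z(β')`.
  set m := (β - β') * E with hm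
  obtain ⟨i⟩ := ‹Nonempty ι›
  have hZ0 : 0 < Z := (hs β hβ).tsum_pos (fun n => (Real.exp_pos _).le) i (Real.exp_pos _)
  have hsum : HasSum (fun n => Real.exp m * ((1 - m) * Real.exp (-β * e n) +
      (β - β') * (e n * Real.exp (-β * e n)))) (Real.exp m * ((1 - m) * Z + (β - β') * (E * Z))) := by
    have h1 := (summable_mul_exp_neg he hs hβ).hasSum
    rw [h] at h1
    exact (((hs β hβ).hasSum.mul_left _).add (h1.mul_left _)).mul_left _
  have hle : Real.exp m * Z ≤ ∑' n, Real.exp (-β' * e n) := by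
    have h2 : Real.exp m * Z = Real.exp m * ((1 - m) * Z + (β - β') * (E * Z)) := by
      rw [hm]; ring
    rw [h2, ← hsum.tsum_eq]
    refine hsum.summable.tsum_le_tsum (fun n => ?_) (hs β' hβ')
    have h3 := Real.add_one_le_exp ((β - β') * e n - m)
    have h4 : Real.exp (-β' * e n) =
        Real.exp m * (Real.exp (-β * e n) * Real.exp ((β - β') * e n - m)) := by
      rw [← Real.exp_add, ← Real.exp_add]; ring_nf
    rw [h4]
    refine mul_le_mul_of_nonneg_left ?_ (Real.exp_pos _).le
    have h5 := mul_le_mul_of_nonneg_left h3 (Real.exp_pos (-β * e n)).le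
    linarith
  have hlog := Real.log_le_log (by positivity) hle
  rw [Real.log_mul (Real.exp_pos m).ne' hZ0.ne', Real.log_exp, hm] at hlog
  linarith

/-! ### Trace and entropy of diagonal operators -/

theorem HilbertBasis.tsum_enorm_inner_sq {ι A : Type*} [NormedAddCommGroup A]
    [InnerProductSpace ℂ A] (c : HilbertBasis ι ℂ A) (x : A) :
    ∑' i, ENNReal.ofReal (‖⟪c i, x⟫_ℂ‖ ^ 2) = ENNReal.ofReal (‖x‖ ^ 2) := by
  have h : HasSum (fun i => ‖⟪c i, x⟫_ℂ‖ ^ 2) (‖x‖ ^ 2) := by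
    have h1 := Complex.hasSum_re (c.hasSum_inner_mul_inner x x)
    rw [inner_self_eq_norm_sq_to_K] at h1
    convert h1 using 1
    · ext i
      rw [← inner_conj_symm x, ← Complex.normSq_eq_conj_mul_self, Complex.ofReal_re,
        Complex.normSq_eq_norm_sq]
    · norm_cast
  rw [← h.tsum_eq, ENNReal.ofReal_tsum_of_nonneg (fun i => sq_nonneg _) h.summable]

theorem HilbertBasis.inner_apply_of_diagonal {ι A : Type*} [NormedAddCommGroup A]
    [InnerProductSpace ℂ A] (b : HilbertBasis ι ℂ A) {T : A →L[ℂ] A} {t : ι → ℝ}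
    (hT : ∀ n, T (b n) = (t n : ℂ) • b n) (n : ι) (x : A) :
    ⟪b n, T x⟫_ℂ = t n * ⟪b n, x⟫_ℂ := by
  have hd : Dense (Submodule.span ℂ (Set.range b) : Set A) :=
    Submodule.dense_iff_topologicalClosure_eq_top.2 b.dense_span
  have h : (innerSL ℂ (b n)) ∘L T = (t n : ℂ) • innerSL ℂ (b n) := by
    refine ContinuousLinearMap.ext_on hd ?_
    rintro _ ⟨m, rfl⟩
    by_cases hnm : n = m
    · simp [hT, hnm]
    · simp [hT, b.orthonormal.2 hnm]
  exact congrArg (fun L : A →L[ℂ] ℂ => L x) h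

/-- Frees the trace from the basis chosen in its definition: expand in `b`, exchange the two
nonnegative sums, and apply Parseval to each `b n`. -/
theorem posTrace_of_diagonal {ι A : Type*} [NormedAddCommGroup A] [InnerProductSpace ℂ A]
    [CompleteSpace A] (b : HilbertBasis ι ℂ A) {T : A →L[ℂ] A} {t : ι → ℝ} (ht : ∀ n, 0 ≤ t n)
    (hT : ∀ n, T (b n) = (t n : ℂ) • b n) :
    posTrace T = ∑' n, ENNReal.ofReal (t n) := by
  unfold posTrace
  set c := (exists_hilbertBasis ℂ A).choose_spec.choose with hc
  have key : ∀ x : A, ENNReal.ofReal (⟪x, T x⟫_ℂ).re =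
      ∑' n, ENNReal.ofReal (t n) * ENNReal.ofReal (‖⟪x, b n⟫_ℂ‖ ^ 2) := by
    intro x
    have h : HasSum (fun n => t n * ‖⟪x, b n⟫_ℂ‖ ^ 2) (⟪x, T x⟫_ℂ).re := by
      convert Complex.hasSum_re (b.hasSum_inner_mul_inner x (T x)) using 1
      ext n
      rw [b.inner_apply_of_diagonal hT, mul_left_comm, ← inner_conj_symm (b n) x, Complex.mul_conj,
        Complex.re_ofReal_mul, Complex.ofReal_re, Complex.normSq_eq_norm_sq]
    rw [← h.tsum_eq, ENNReal.ofReal_tsum_of_nonneg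
      (fun n => mul_nonneg (ht n) (sq_nonneg _)) h.summable]
    exact tsum_congr fun n => ENNReal.ofReal_mul (ht n)
  simp only [key]
  rw [ENNReal.tsum_comm]
  refine tsum_congr fun n => ?_
  rw [ENNReal.tsum_mul_left, c.tsum_enorm_inner_sq, b.orthonormal.1]
  simp

theorem isSelfAdjoint_of_diagonal {ι A : Type*} [NormedAddCommGroup A] [InnerProductSpace ℂ A]
    [CompleteSpace A] (b : HilbertBasis ι ℂ A) {T : A →L[ℂ] A} {t : ι → ℝ}
    (hT : ∀ n, T (b n) = (t n : ℂ) • b n) : IsSelfAdjoint T := by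
  have hd : Dense (Submodule.span ℂ (Set.range b) : Set A) :=
    Submodule.dense_iff_topologicalClosure_eq_top.2 b.dense_span
  rw [ContinuousLinearMap.isSelfAdjoint_iff']
  refine ContinuousLinearMap.ext_on hd ?_
  rintro _ ⟨n, rfl⟩
  refine ext_inner_right ℂ fun x => ?_
  rw [ContinuousLinearMap.adjoint_inner_left, b.inner_apply_of_diagonal hT, hT, inner_smul_left,
    Complex.conj_ofReal]

/-- The continuous functional calculus acts on eigenvectors through the eigenvalue. -/
theorem cfc_apply_eigenvector {A : Type*} [NormedAddCommGroup A] [InnerProductSpace ℂ A]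
    [CompleteSpace A] {T : A →L[ℂ] A} (hT : IsSelfAdjoint T) {p : ℝ} {v : A}
    (hv : T v = (p : ℂ) • v) {f : ℝ → ℝ} (hf : Continuous f) :
    cfc f T v = (f p : ℂ) • v := by
  rcases eq_or_ne v 0 with rfl | hv0
  · simp
  have hp : p ∈ spectrum ℝ T := by
    intro hu
    refine hv0 ?_
    obtain ⟨u, hu⟩ := hu
    have h1 : (u : A →L[ℂ] A) v = 0 := by
      rw [hu]
      simp [hv, Algebra.algebraMap_eq_smul_one]
    calc v = ((↑u⁻¹ : A →L[ℂ] A) * (u : A →L[ℂ] A)) v := by simp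
      _ = (↑u⁻¹ : A →L[ℂ] A) ((u : A →L[ℂ] A) v) := rfl
      _ = 0 := by rw [h1, map_zero]
  -- Stone–Weierstrass: the identity holds for constants and the coordinate function, and survives
  -- sums, products and limits.
  have key : ∀ g : C(spectrum ℝ T, ℝ), cfcHom hT g v = (g ⟨p, hp⟩ : ℂ) • v := by
    intro g
    induction g using ContinuousMap.induction_on_of_compact with
    | const r =>
      have h : ContinuousMap.const (spectrum ℝ T) r = algebraMap ℝ C(spectrum ℝ T, ℝ) r := rfl
      rw [h, AlgHomClass.commutes]
      simp [Algebra.algebraMap_eq_smul_one]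
    | id => rw [cfcHom_id]; simpa using hv
    | star_id => rw [map_star, cfcHom_id, hT.star_eq]; simpa using hv
    | add f g hf hg => simp [map_add, hf, hg, add_smul]
    | mul f g hf hg =>
      rw [map_mul, mul_apply_eq_comp, hg, map_smul, hf, smul_smul, mul_comm]
      simp
    | frequently f h =>
      have hclosed : IsClosed {g : C(spectrum ℝ T, ℝ) |
          cfcHom hT g v = (g ⟨p, hp⟩ : ℂ) • v} := by
        refine isClosed_eq ?_ ?_
        · exact (ContinuousLinearMap.apply ℂ A v).continuous.comp (cfcHom_continuous hT)
        · exact (Complex.continuous_ofReal.comp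
            (continuous_eval_const _)).smul continuous_const
      exact hclosed.mem_of_frequently_of_tendsto h Filter.tendsto_id
  rw [cfc_apply f T hT hf.continuousOn, key]
  rfl

/-- The bounds on `p` make every `-p log p` nonnegative, so the truncation in `posTrace` loses
nothing. -/
theorem vonNeumannEntropy_of_diagonal {ι A : Type*} [NormedAddCommGroup A]
    [InnerProductSpace ℂ A] [CompleteSpace A] (b : HilbertBasis ι ℂ A) {a : ℝ} (ha : 1 < a)
    {ρ : A →L[ℂ] A} {p : ι → ℝ} (hp0 : ∀ n, 0 ≤ p n) (hp1 : ∀ n, p n ≤ 1)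
    (hρ : ∀ n, ρ (b n) = (p n : ℂ) • b n) :
    vonNeumannEntropy a ρ = ∑' n, ENNReal.ofReal (-(p n * Real.logb a (p n))) := by
  have hc : Continuous fun x : ℝ => -(x * Real.logb a x) := by
    have h : (fun x : ℝ => -(x * Real.logb a x)) = fun x => -(x * Real.log x) / Real.log a := by
      ext x; simp only [Real.logb]; ring
    rw [h]
    exact Real.continuous_mul_log.neg.div_const _
  exact posTrace_of_diagonal b
    (fun n => neg_nonneg.2 (mul_nonpos_of_nonneg_of_nonpos (hp0 n)
      (Real.logb_nonpos ha (hp0 n) (hp1 n))))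
    (fun n => cfc_apply_eigenvector (isSelfAdjoint_of_diagonal b hρ) (hρ n) hc)

/-! ### Gibbs states and their entropy -/

namespace Hamiltonian

variable {A : Type*} [NormedAddCommGroup A] [InnerProductSpace ℂ A] [CompleteSpace A]

theorem isFunctionOf_fc (H : Hamiltonian A) {f : ℝ → ℝ} {C : ℝ}
    (hf : ∀ e ∈ pointSpectrum H.op, |f e| ≤ C) : H.IsFunctionOf f (H.fc f) := by
  have h : ∃ T : A →L[ℂ] A, H.IsFunctionOf f T := (H.existsUnique_isFunctionOf f C hf).exists
  rw [fc, dif_pos h]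
  exact h.choose_spec

theorem isFunctionOf_fc_indicator (H : Hamiltonian A) :
    H.IsFunctionOf (fun x => if x = 0 then 1 else 0) (H.fc fun x => if x = 0 then 1 else 0) :=
  H.isFunctionOf_fc (C := 1) fun e _ => by
    by_cases h : e = 0 <;> simp [h]

theorem isFunctionOf_fc_exp (H : Hamiltonian A) {β : ℝ} (hβ : 0 < β) :
    H.IsFunctionOf (fun x => Real.exp (-β * x)) (H.fc fun x => Real.exp (-β * x)) :=
  H.isFunctionOf_fc (C := 1) fun e he => by
    rw [abs_of_pos (Real.exp_pos _), Real.exp_le_one_iff]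
    nlinarith [H.ground_energy.2 he]

theorem isFunctionOf_fc_mul_exp (H : Hamiltonian A) {β : ℝ} (hβ : 0 < β) :
    H.IsFunctionOf (fun x => x * Real.exp (-β * x)) (H.fc fun x => x * Real.exp (-β * x)) :=
  H.isFunctionOf_fc (C := β⁻¹) fun e he => by
    have he0 : 0 ≤ e := H.ground_energy.2 he
    rw [abs_of_nonneg (mul_nonneg he0 (Real.exp_pos _).le), neg_mul, Real.exp_neg,
      ← div_eq_mul_inv, div_le_iff₀ (Real.exp_pos _)]
    have h := Real.add_one_le_exp (β * e)
    calc e = β⁻¹ * (β * e) := by field_simp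
      _ ≤ β⁻¹ * Real.exp (β * e) := by gcongr; linarith

theorem exists_eigenbasis_energies (H : Hamiltonian A) :
    ∃ (b : HilbertBasis ℕ ℂ A) (e : ℕ → ℝ), (∀ n, IsEigenpair H.op (e n) (b n)) ∧
      (∀ n, 0 ≤ e n) ∧ ∃ n, e n = 0 := by
  obtain ⟨b, hb⟩ := H.exists_eigenbasis
  choose e he using hb
  refine ⟨b, e, he, fun n => H.ground_energy.2 ⟨b n, b.orthonormal.ne_zero n, he n⟩, ?_⟩
  -- A zero-energy eigenvector `x` need not belong to the basis. If no basis vector had energy `0`,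
  -- the ground projection would kill all of them while fixing `x`, forcing `x = 0`.
  by_contra! hne
  obtain ⟨x, hx0, hx⟩ := H.ground_energy.1
  refine hx0 (b.repr.injective ?_)
  ext n
  have h1 := b.inner_apply_of_diagonal (fun m => H.isFunctionOf_fc_indicator _ _ (he m)) n x
  rw [H.isFunctionOf_fc_indicator _ _ hx] at h1
  simpa [hne n, b.repr_apply_apply] using h1

section Energies

variable {H : Hamiltonian A} {b : HilbertBasis ℕ ℂ A} {e : ℕ → ℝ}

theorem partitionFunction_eq (hb : ∀ n, IsEigenpair H.op (e n) (b n)) {β : ℝ} (hβ : 0 < β) :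
    H.partitionFunction β = ∑' n, ENNReal.ofReal (Real.exp (-β * e n)) :=
  posTrace_of_diagonal b (fun _ => (Real.exp_pos _).le)
    fun n => H.isFunctionOf_fc_exp hβ _ _ (hb n)

theorem summable_exp_neg (hH : H.GibbsHypothesis) (hb : ∀ n, IsEigenpair H.op (e n) (b n))
    {β : ℝ} (hβ : 0 < β) : Summable fun n => Real.exp (-β * e n) := by
  have h := hH β hβ
  rw [partitionFunction_eq hb hβ] at h
  simpa [ENNReal.toReal_ofReal, (Real.exp_pos _).le] using ENNReal.summable_toReal h.ne

theorem partitionFunction_eq_ofReal (hH : H.GibbsHypothesis)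
    (hb : ∀ n, IsEigenpair H.op (e n) (b n)) {β : ℝ} (hβ : 0 < β) :
    H.partitionFunction β = ENNReal.ofReal (∑' n, Real.exp (-β * e n)) := by
  rw [partitionFunction_eq hb hβ, ENNReal.ofReal_tsum_of_nonneg (fun n => (Real.exp_pos _).le)
    (summable_exp_neg hH hb hβ)]

theorem isInverseTemperature_iff (hH : H.GibbsHypothesis)
    (hb : ∀ n, IsEigenpair H.op (e n) (b n)) (he : ∀ n, 0 ≤ e n) {E : ℝ} (hE : 0 ≤ E) {β : ℝ} :
    H.IsInverseTemperature E β ↔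
      0 < β ∧ ∑' n, e n * Real.exp (-β * e n) = E * ∑' n, Real.exp (-β * e n) := by
  refine and_congr_right fun hβ => ?_
  have h0 : ∀ n, 0 ≤ e n * Real.exp (-β * e n) := fun n => mul_nonneg (he n) (Real.exp_pos _).le
  rw [posTrace_of_diagonal b h0 fun n => H.isFunctionOf_fc_mul_exp hβ _ _ (hb n),
    partitionFunction_eq_ofReal hH hb hβ, ← ENNReal.ofReal_mul hE,
    ← ENNReal.ofReal_tsum_of_nonneg h0
      (summable_mul_exp_neg he (fun _ => summable_exp_neg hH hb) hβ),
    ENNReal.ofReal_eq_ofReal_iff (tsum_nonneg h0)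
      (mul_nonneg hE (tsum_nonneg fun n => (Real.exp_pos _).le))]

/-- Existence of a solution is enough: whichever one is picked, the later arguments use only this
equation, never uniqueness. -/
theorem inverseTemperature_spec (hH : H.GibbsHypothesis)
    (hb : ∀ n, IsEigenpair H.op (e n) (b n)) (he : ∀ n, 0 ≤ e n) {n₀ : ℕ} (h₀ : e n₀ = 0)
    {E : ℝ} (hE : 0 < E) :
    0 < H.inverseTemperature E ∧ ∑' n, e n * Real.exp (-H.inverseTemperature E * e n) =
      E * ∑' n, Real.exp (-H.inverseTemperature E * e n) := by
  rw [← isInverseTemperature_iff hH hb he hE.le]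
  obtain ⟨β, hβ⟩ := exists_tsum_mul_exp_neg_eq he h₀ (fun _ => summable_exp_neg hH hb) hE
  exact Classical.epsilon_spec
    (p := fun β => H.IsInverseTemperature E β)
    ⟨β, (isInverseTemperature_iff hH hb he hE.le).2 hβ⟩

/-- The entropy of the Gibbs state of energy `E > 0` is `(β E + log Z(β)) / log a`. -/
theorem vonNeumannEntropy_gibbsState (hH : H.GibbsHypothesis)
    (hb : ∀ n, IsEigenpair H.op (e n) (b n)) (he : ∀ n, 0 ≤ e n) {n₀ : ℕ} (h₀ : e n₀ = 0)
    {a : ℝ} (ha : 1 < a) {E : ℝ} (hE : 0 < E) :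
    vonNeumannEntropy a (H.gibbsState E) = ENNReal.ofReal ((H.inverseTemperature E * E +
      Real.log (∑' n, Real.exp (-H.inverseTemperature E * e n))) / Real.log a) := by
  obtain ⟨hβ, hmean⟩ := inverseTemperature_spec hH hb he h₀ hE
  rw [gibbsState, if_neg hE.ne', partitionFunction_eq_ofReal hH hb hβ]
  set β := H.inverseTemperature E
  have hs := summable_exp_neg hH hb hβ
  have hZ1 := one_le_tsum_exp_neg h₀ hs
  set Z := ∑' n, Real.exp (-β * e n) with hZ
  have hZ0 : 0 < Z := one_pos.trans_le hZ1
  have hp0 : ∀ n, 0 < Z⁻¹ * Real.exp (-β * e n) := fun n => by positivity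
  have hp1 : ∀ n, Z⁻¹ * Real.exp (-β * e n) ≤ 1 := fun n => by
    rw [inv_mul_le_one₀ hZ0]
    exact hs.le_tsum n fun m _ => (Real.exp_pos _).le
  rw [vonNeumannEntropy_of_diagonal b ha (fun n => (hp0 n).le) hp1 fun n => by
    rw [smul_apply, H.isFunctionOf_fc_exp hβ _ _ (hb n), smul_smul,
      ENNReal.toReal_ofReal hZ0.le, Complex.ofReal_mul]]
  -- With `p n = exp (-β * e n) / Z` one has `-log (p n) = β * e n + log Z`.
  have hterm : ∀ n, -(Z⁻¹ * Real.exp (-β * e n) * Real.logb a (Z⁻¹ * Real.exp (-β * e n))) =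
      (β * (e n * Real.exp (-β * e n)) + Real.log Z * Real.exp (-β * e n)) *
        (Z * Real.log a)⁻¹ := fun n => by
    rw [Real.logb, Real.log_mul (inv_pos.2 hZ0).ne' (Real.exp_pos _).ne', Real.log_exp,
      Real.log_inv, mul_inv]
    ring
  have hsum : HasSum (fun n => -(Z⁻¹ * Real.exp (-β * e n) *
      Real.logb a (Z⁻¹ * Real.exp (-β * e n)))) ((β * E + Real.log Z) / Real.log a) := by
    have h1 := (summable_mul_exp_neg he (fun _ => summable_exp_neg hH hb) hβ).hasSum
    rw [hmean] at h1
    simp only [hterm]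
    have h2 : (β * E + Real.log Z) / Real.log a =
        (β * (E * Z) + Real.log Z * Z) * (Z * Real.log a)⁻¹ := by
      have := (Real.log_pos ha).ne'
      field_simp
    rw [h2]
    exact ((h1.mul_left β).add (hs.hasSum.mul_left (Real.log Z))).mul_right _
  rw [← hsum.tsum_eq, ENNReal.ofReal_tsum_of_nonneg (fun n => ?_) hsum.summable]
  exact neg_nonneg.2 (mul_nonpos_of_nonneg_of_nonpos (hp0 n).le
    (Real.logb_nonpos ha (hp0 n).le (hp1 n)))

/-- The ground space has finite dimension, since each ground level adds `1` to `Z(1) < ∞`; the state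
is uniform on it. -/
theorem vonNeumannEntropy_gibbsState_zero_lt_top (hH : H.GibbsHypothesis)
    (hb : ∀ n, IsEigenpair H.op (e n) (b n)) {n₀ : ℕ} (h₀ : e n₀ = 0) {a : ℝ} (ha : 1 < a) :
    vonNeumannEntropy a (H.gibbsState 0) < ∞ := by
  set q : ℕ → ℝ := fun n => if e n = 0 then 1 else 0 with hq
  have hq0 : ∀ n, 0 ≤ q n := fun n => by simp only [hq]; split_ifs <;> norm_num
  have hP : posTrace (H.fc fun x => if x = 0 then 1 else 0) = ∑' n, ENNReal.ofReal (q n) :=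
    posTrace_of_diagonal b hq0 fun n => H.isFunctionOf_fc_indicator _ _ (hb n)
  have hfin : ∑' n, ENNReal.ofReal (q n) < ∞ := by
    refine lt_of_le_of_lt (ENNReal.tsum_le_tsum fun n => ENNReal.ofReal_le_ofReal ?_)
      (partitionFunction_eq hb one_pos ▸ hH 1 one_pos)
    by_cases h : e n = 0
    · simp [hq, h]
    · simpa [hq, h] using (Real.exp_pos _).le
  have hd : 1 ≤ (∑' n, ENNReal.ofReal (q n)).toReal := by
    rw [← ENNReal.toReal_one, ENNReal.toReal_le_toReal ENNReal.one_ne_top hfin.ne]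
    simpa [hq, h₀] using ENNReal.le_tsum (f := fun n => ENNReal.ofReal (q n)) n₀
  rw [gibbsState, if_pos rfl, hP]
  set d := (∑' n, ENNReal.ofReal (q n)).toReal
  have hd0 : 0 ≤ d⁻¹ := inv_nonneg.2 (one_pos.le.trans hd)
  have hp1 : ∀ n, d⁻¹ * q n ≤ 1 := fun n => by
    have := inv_le_one_of_one_le₀ hd
    simp only [hq]; split_ifs <;> simp [this]
  rw [vonNeumannEntropy_of_diagonal b ha (fun n => mul_nonneg hd0 (hq0 n)) hp1 fun n => by
    rw [smul_apply, H.isFunctionOf_fc_indicator _ _ (hb n), smul_smul,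
      Complex.ofReal_mul]]
  have hterm : ∀ n, ENNReal.ofReal (-(d⁻¹ * q n * Real.logb a (d⁻¹ * q n))) =
      ENNReal.ofReal (q n) * ENNReal.ofReal (-(d⁻¹ * Real.logb a d⁻¹)) := fun n => by
    by_cases h : e n = 0 <;> simp [hq, h]
  simp only [hterm]
  rw [ENNReal.tsum_mul_right]
  exact ENNReal.mul_lt_top hfin ENNReal.ofReal_lt_top

/-- Use `β' = β(E/δ)` as trial temperature at energy `E / l`. The energy term `l * (β' * (E / l))`
does not see `l`, and `log Z(β') ≥ 0` lets `l` grow to `δ`. -/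
theorem mul_vonNeumannEntropy_gibbsState_le (hH : H.GibbsHypothesis)
    (hb : ∀ n, IsEigenpair H.op (e n) (b n)) (he : ∀ n, 0 ≤ e n) {n₀ : ℕ} (h₀ : e n₀ = 0)
    {a : ℝ} (ha : 1 < a) {E : ℝ} (hE : 0 < E) {l δ : ℝ} (hl : 0 < l) (hlδ : l ≤ δ) :
    ENNReal.ofReal l * vonNeumannEntropy a (H.gibbsState (E / l)) ≤
      ENNReal.ofReal δ * vonNeumannEntropy a (H.gibbsState (E / δ)) := by
  have hδ : 0 < δ := hl.trans_le hlδ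
  have hEl := div_pos hE hl
  have hEδ := div_pos hE hδ
  rw [vonNeumannEntropy_gibbsState hH hb he h₀ ha hEl,
    vonNeumannEntropy_gibbsState hH hb he h₀ ha hEδ, ← ENNReal.ofReal_mul hl.le,
    ← ENNReal.ofReal_mul hδ.le]
  refine ENNReal.ofReal_le_ofReal ?_
  obtain ⟨hβ, hmean⟩ := inverseTemperature_spec hH hb he h₀ hEl
  have hβ' := (inverseTemperature_spec hH hb he h₀ hEδ).1
  set β := H.inverseTemperature (E / l)
  set β' := H.inverseTemperature (E / δ)
  have hvar := gibbs_variational he (fun _ => summable_exp_neg hH hb) hβ hβ' hmean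
  have hlog := Real.log_nonneg (one_le_tsum_exp_neg h₀ (summable_exp_neg hH hb hβ'))
  set L' := Real.log (∑' n, Real.exp (-β' * e n))
  rw [← mul_div_assoc l, ← mul_div_assoc δ]
  refine div_le_div_of_nonneg_right ?_ (Real.log_pos ha).le
  calc _ ≤ l * (β' * (E / l) + L') := mul_le_mul_of_nonneg_left hvar hl.le
    _ = β' * E + l * L' := by field_simp
    _ ≤ β' * E + δ * L' := by gcongr
    _ = δ * (β' * (E / δ) + L') := by field_simp

end Energies

end Hamiltonian

theorem mainTheorem7 {A : Type*} [NormedAddCommGroup A] [InnerProductSpace ℂ A] [CompleteSpace A]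
    (H : Hamiltonian A) (hH : H.GibbsHypothesis) (a : ℝ) (ha : 1 < a)
    (E : ℝ) (hE : 0 ≤ E) (δ : ℝ) (hδ : 0 < δ) :
    (⨆ l ∈ Set.Ioc 0 δ, ENNReal.ofReal l * vonNeumannEntropy a (H.gibbsState (E / l))) =
        ENNReal.ofReal δ * vonNeumannEntropy a (H.gibbsState (E / δ)) ∧
      vonNeumannEntropy a (H.gibbsState (E / δ)) < ∞ := by
  obtain ⟨b, e, hb, he, n₀, h₀⟩ := H.exists_eigenbasis_energies
  refine ⟨le_antisymm (iSup₂_le fun l hl => ?_)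
    (le_iSup₂_of_le δ (Set.right_mem_Ioc.2 hδ) le_rfl), ?_⟩
  · rcases hE.eq_or_lt with rfl | hE
    · simp only [zero_div]
      gcongr
      exact hl.2
    · exact Hamiltonian.mul_vonNeumannEntropy_gibbsState_le hH hb he h₀ ha hE hl.1 hl.2
  · rcases hE.eq_or_lt with rfl | hE
    · rw [zero_div]
      exact Hamiltonian.vonNeumannEntropy_gibbsState_zero_lt_top hH hb h₀ ha
    · rw [Hamiltonian.vonNeumannEntropy_gibbsState hH hb he h₀ ha (div_pos hE hδ)]
      exact ENNReal.ofReal_lt_top
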